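/- Let $(\mathcal B,\|\cdot\|)$ be a real Banach space that is $(2,D)$-smooth for some $D>0$, i.e. $\|x+y\|^2+\|x-y\|^2\le 2\|x\|^2+2D^2\|y\|^2$ for all $x,y\in\mathcal B$. Let $1\le m<N$ be integers, let $v_1,\dots,v_N\in\mathcal B$ be vectors (not necessarily distinct), and put $\bar v=\frac1N\sum_{i=1}^N v_i$ and $R_v=\max_{1\le i\le N}\|v_i\|$. Let $V_1,\dots,V_m$ be obtained by uniform sampling without replacement from $v_1,\dots,v_N$: $V_k=v_{I_k}$, where $(I_1,\dots,I_m)$ is uniformly distributed over the $m$-tuples of pairwise distinct elements of $\{1,\dots,N\}$. Write $\mathbb E_{k-1}$ for the conditional expectation given $\sigma(V_1,\dots,V_{k-1})$ (so $\mathbb E_0$ is the expectation) and $$\sigma_m=\frac{1}{\sqrt{\sum_{k=1}^m\frac1{(N-k)^2}}}\;\Big\|\Big(\sum_{k=1}^m\frac{1}{(N-k)^2}\,\mathbb E_{k-1}\|V_k-\mathbb E_{k-1}V_k\|^2\Big)^{1/2}\Big\|_\infty ,$$ where $\|\cdot\|_\infty$ is the essential supremum norm. Then for every $\varepsilon>0$,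 $$\mathbb P\Big(\Big\|\frac1m\sum_{i=1}^m V_i-\bar v\Big\|\ge\varepsilon\Big)\le 2\exp\left(-\frac{m\varepsilon^2}{2\left(2D^2\frac{N-m}{N}\sigma_m^2+\varepsilon R_v/3\right)}\right),$$ where, if the denominator is $0$ (which happens only if all $v_i=0$), the right-hand side is read as $2$. -/

import Mathlib

open MeasureTheory ProbabilityTheory
open scoped ENNReal

noncomputable section

/-- The normed space `E` is `(2, D)`-smooth. -/
def IsTwoSmooth (E : Type*) [NormedAddCommGroup E] (D : ℝ) : Prop :=
  0 < D ∧ ∀ x y : E, ‖x + y‖ ^ 2 + ‖x - y‖ ^ 2 ≤ 2 * ‖x‖ ^ 2 + 2 * D ^ 2 * ‖y‖ ^ 2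

/-- `I 0, …, I (m - 1)` are the successive (random) labels obtained when `m` elements are drawn
uniformly without replacement from `N` labelled elements: the tuple of labels is uniformly
distributed over the `N (N - 1) ⋯ (N - m + 1)` injective tuples. -/
structure IsSamplingWithoutReplacement {Ω : Type*} [MeasurableSpace Ω] (μ : Measure Ω)
    {N m : ℕ} (I : Fin m → Ω → Fin N) : Prop where
  measurable : ∀ k, Measurable (I k)
  uniform : ∀ a : Fin m → Fin N, Function.Injective a →
    μ {ω | ∀ k, I k ω = a k} = ((N.descFactorial m : ℕ) : ℝ≥0∞)⁻¹

/-- The σ-algebra generated by the variables `V i` with `i < k`. The index `k : Fin m` is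
zero-based, so this is the information available just before `V k` is drawn; it is trivial
for `k = 0`. -/
@[reducible]
def pastSigma {Ω E : Type*} [NormedAddCommGroup E] {m : ℕ}
    (V : Fin m → Ω → E) (k : Fin m) : MeasurableSpace Ω :=
  ⨆ i : Fin m, ⨆ _ : i < k, MeasurableSpace.comap (V i) (borel E)

/-- The conditional variance `𝔼_{k-1} ‖V_k - 𝔼_{k-1} V_k‖²`, as a random variable. -/
def stepVariance {Ω E : Type*} [MeasurableSpace Ω] [NormedAddCommGroup E] [NormedSpace ℝ E]
    [CompleteSpace E] (μ : Measure Ω) {m : ℕ} (V : Fin m → Ω → E) (k : Fin m) : Ω → ℝ :=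
  μ[fun ω => ‖V k ω - (μ[V k | pastSigma V k]) ω‖ ^ 2 | pastSigma V k]

/-- The weight `1 / (N - k)²` of the `k`-th draw, where the one-based number of the draw
with zero-based index `k : Fin m` is `k + 1`. -/
def stepWeight (N : ℕ) {m : ℕ} (k : Fin m) : ℝ :=
  1 / ((N : ℝ) - ((k : ℕ) + 1 : ℝ)) ^ 2

/-- The standard deviation `σ_m` for sampling without replacement: the `L^∞` norm of the square
root of the weighted sum of the conditional variances, divided by the square root of the sum of
the weights. -/
def samplingSigma {Ω E : Type*} [MeasurableSpace Ω] [NormedAddCommGroup E] [NormedSpace ℝ E]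
    [CompleteSpace E] (μ : Measure Ω) (N : ℕ) {m : ℕ} (V : Fin m → Ω → E) : ℝ :=
  1 / √(∑ k : Fin m, stepWeight N k) *
    (eLpNorm (fun ω => √(∑ k : Fin m, stepWeight N k * stepVariance μ V k ω)) ∞ μ).toReal

end

/-! The normalised deviations `M_k = (S_k - (k/N) ∑ v_i) / (N - k)` of the partial sums `S_k` form a
martingale, because the conditional mean of a draw given the past is the mean of the vectors that
remain. With zero-based `k`, the increment `drawIncrement` is the deviation of the draw from this
mean divided by `N - k - 1`. Its conditional second moment is therefore exactly the `k`-th term in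
the definition of `σ_m`, and its norm is at most `2R/(N - k)`.

For such a martingale `IsTwoSmooth.measure_norm_sum_ge_le` runs Pinelis' argument: `cosh (s‖M_k‖)`,
discounted by the exponential of the accumulated conditional variance, is a supermartingale. Its
one-step estimate `IsTwoSmooth.exists_cosh_norm_add_le` rests on a supporting functional and the
sharp quadratic bound `IsTwoSmooth.norm_add_sq_le`. Markov's inequality then gives a tail bound with
a free parameter `s`.

Put `n = N - m`. The weights sum to at most `m (n + 1) / (n² N)` and the increments are bounded by
`2R/(n + 1)`. Bernstein's choice of `s` would yield the variance factor `n + 1` instead of `2n`,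
which is better than required, but the range `2nR/(n + 1)` instead of `R`, which is worse. Both
discrepancies are the same factor `2n/(n + 1)`, between 1 and 2, and `exists_rate_le` trades one for
the other at the level of the full rate function of `exp θ - 1 - θ`. -/

/-! ### Scalar inequalities: the exponential remainder, its rate function, hyperbolic functions. -/

/-- The power series of `exp u - 1 - u`. -/
theorem hasSum_exp_sub_one_sub_id (u : ℝ) :
    HasSum (fun k : ℕ => u ^ (k + 2) / ((k + 2).factorial : ℝ)) (Real.exp u - 1 - u) := by
  have h : HasSum (fun k : ℕ => u ^ k / (k.factorial : ℝ)) (Real.exp u) := by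
    rw [Real.exp_eq_exp_ℝ]
    exact NormedSpace.expSeries_div_hasSum_exp u
  have h2 := (hasSum_nat_add_iff' 2).mpr h
  have e : Real.exp u - ∑ i ∈ Finset.range 2, u ^ i / (i.factorial : ℝ) = Real.exp u - 1 - u := by
    simp [Finset.sum_range_succ, sub_sub]
  rwa [e] at h2

theorem exp_sub_one_sub_id_nonneg (u : ℝ) : 0 ≤ Real.exp u - 1 - u := by
  linarith [Real.add_one_le_exp u]

/-- The function `(exp u - 1 - u) / u ^ 2` is monotone. -/
theorem exp_sub_one_sub_id_le_mul {u a : ℝ} (hu : 0 ≤ u) (hua : u ≤ a) (ha : 0 < a) :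
    Real.exp u - 1 - u ≤ u ^ 2 * ((Real.exp a - 1 - a) / a ^ 2) := by
  have h2 := ((hasSum_exp_sub_one_sub_id a).div_const (a ^ 2)).mul_left (u ^ 2)
  refine hasSum_le (fun k => ?_) (hasSum_exp_sub_one_sub_id u) h2
  have : u ^ 2 * (a ^ (k + 2) / ((k + 2).factorial : ℝ) / a ^ 2)
      = u ^ 2 * a ^ k / ((k + 2).factorial : ℝ) := by
    field_simp
    ring
  rw [this, pow_add, mul_comm (u ^ k)]
  gcongr

/-- Bernstein's bound on `exp θ - 1 - θ`. -/
theorem exp_sub_one_sub_id_le_bernstein {θ : ℝ} (h0 : 0 ≤ θ) (h3 : θ < 3) :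
    Real.exp θ - 1 - θ ≤ θ ^ 2 / (2 * (1 - θ / 3)) := by
  have hg := (hasSum_geometric_of_lt_one (r := θ / 3) (by positivity) (by linarith)).mul_left
    (θ ^ 2 / 2)
  have e : θ ^ 2 / (2 * (1 - θ / 3)) = θ ^ 2 / 2 * (1 - θ / 3)⁻¹ := by
    rw [div_mul_eq_div_div, div_eq_mul_inv (θ ^ 2 / 2)]
  rw [e]
  refine hasSum_le (fun k => ?_) (hasSum_exp_sub_one_sub_id θ) hg
  have hf : (2 : ℝ) * 3 ^ k ≤ ((k + 2).factorial : ℝ) := by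
    have := Nat.factorial_mul_pow_le_factorial (m := 2) (n := k)
    rw [add_comm 2 k] at this
    exact_mod_cast this
  rw [div_pow, div_mul_div_comm, pow_add, mul_comm (θ ^ k)]
  gcongr

theorem sq_div_two_le_exp_sub_one_sub_id {a : ℝ} (ha : 0 ≤ a) :
    a ^ 2 / 2 ≤ Real.exp a - 1 - a := by
  linarith [Real.quadratic_le_exp_of_nonneg ha]

/-- The Legendre transform of `exp θ - 1 - θ` dominates an interpolation between Bernstein's
rate function (`c = 1`) and the one with doubled variance and halved range (`c = 1 / 2`). -/
theorem exists_rate_le {c t : ℝ} (hc : 1 / 2 ≤ c) (hc1 : c ≤ 1) (ht : 0 < t) :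
    ∃ θ : ℝ, 0 < θ ∧
      c * t ^ 2 / (2 + 2 * c ^ 2 * t / 3) ≤ θ * t - (Real.exp θ - 1 - θ) := by
  have e1 : Real.exp 1 < 2.7182818286 := Real.exp_one_lt_d9
  have e1' : 0 < Real.exp 1 := Real.exp_pos 1
  have hden : 0 < 2 + 2 * c ^ 2 * t / 3 := by positivity
  have e2 : Real.exp 2 < 7.39 := by
    have : Real.exp 2 = Real.exp 1 ^ 2 := by rw [← Real.exp_nat_mul]; norm_num
    rw [this]; nlinarith
  have e3 : Real.exp 3 < 20.09 := by
    have : Real.exp 3 = Real.exp 1 ^ 2 * Real.exp 1 := by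
      rw [← Real.exp_nat_mul, ← Real.exp_add]; norm_num
    have h2 : Real.exp 1 ^ 2 < 7.38906 := by nlinarith
    rw [this]; nlinarith
  have e32 : Real.exp (3 / 2) < 4.483 := by
    have : Real.exp (3 / 2) ^ 2 = Real.exp 3 := by rw [← Real.exp_nat_mul]; norm_num
    nlinarith [Real.exp_pos (3 / 2)]
  -- As a quadratic in `c`, the inequality `(2qt/3) c² - t² c + 2q ≥ 0` holds for every `c` once its
  -- discriminant `t⁴ - 16 q² t / 3` is nonpositive.
  have disc : ∀ q : ℝ, 0 < q → 3 * t ^ 3 ≤ 16 * q ^ 2 →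
      c * t ^ 2 ≤ q * (2 + 2 * c ^ 2 * t / 3) := by
    intro q hq h
    have h1 : 0 ≤ t * (4 * q * c - 3 * t) ^ 2 := by positivity
    have : 0 ≤ 24 * q * (q * (2 + 2 * c ^ 2 * t / 3) - c * t ^ 2) := by nlinarith
    by_contra hcon
    nlinarith
  rcases le_or_gt t 3 with h3 | h3
  -- Bernstein's `θ` gives the rate for `c = 1`. It dominates the required one exactly when `(1 - c)
  -- (1 - c t / 3) ≥ 0`, which `t ≤ 3` ensures.
  · refine ⟨t / (1 + t / 3), by positivity, ?_⟩
    have hθ3 : t / (1 + t / 3) < 3 := by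
      rw [div_lt_iff₀ (by positivity)]; linarith
    have hb := exp_sub_one_sub_id_le_bernstein (θ := t / (1 + t / 3)) (by positivity) hθ3
    have h1 : 1 - t / (1 + t / 3) / 3 = 1 / (1 + t / 3) := by field_simp; ring
    have hval : t / (1 + t / 3) * t - (t / (1 + t / 3)) ^ 2 / (2 * (1 - t / (1 + t / 3) / 3))
        = t ^ 2 / (2 * (1 + t / 3)) := by
      rw [h1]; field_simp; ring
    refine le_trans ?_ (by linarith : t ^ 2 / (2 * (1 + t / 3)) ≤ _)
    rw [div_le_div_iff₀ hden (by positivity)]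
    have : 0 ≤ (1 - c) * (1 - c * (t / 3)) := by
      apply mul_nonneg <;> nlinarith
    have h2 : 0 ≤ t ^ 2 * ((1 - c) * (1 - c * (t / 3))) := by positivity
    nlinarith
  rcases le_or_gt t 4 with h4 | h4
  -- Beyond `t = 3` a constant `θ` on each range suffices. The decimals 1.983, 4.39 and 16.09 are
  -- upper bounds for `exp θ - 1 - θ` at `θ = 3/2, 2, 3`.
  · refine ⟨3 / 2, by norm_num, ?_⟩
    have hq : 1.5 * t - 1.983 ≤ 3 / 2 * t - (Real.exp (3 / 2) - 1 - 3 / 2) := by linarith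
    refine le_trans ?_ hq
    rw [div_le_iff₀ hden]
    apply disc _ (by linarith)
    nlinarith [mul_nonneg (mul_nonneg (sub_nonneg.2 h3.le) (sub_nonneg.2 h4)) ht.le]
  rcases le_or_gt t 11 with h11 | h11
  · refine ⟨2, by norm_num, ?_⟩
    have hq : 2 * t - 4.39 ≤ 2 * t - (Real.exp 2 - 1 - 2) := by linarith
    refine le_trans ?_ hq
    rw [div_le_iff₀ hden]
    apply disc _ (by linarith)
    nlinarith [mul_nonneg (mul_nonneg (sub_nonneg.2 h4.le) (sub_nonneg.2 h11)) ht.le]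
  · refine ⟨3, by norm_num, ?_⟩
    have hq : 3 * t - 16.09 ≤ 3 * t - (Real.exp 3 - 1 - 3) := by linarith
    refine le_trans ?_ hq
    rw [div_le_iff₀ hden]
    -- The required rate grows with slope `3/(2c) ≤ 3` as `t → ∞`, which dictates `θ = 3`. The
    -- discriminant test fails for large `t`, so the quadratic is expanded at `c = 1/2`: its value
    -- there is affine in `t` and positive, and the remainder is the product below.
    have hd : 0 ≤ (c - 1 / 2) * (2 * t / 3 * (3 * t - 16.09) * (c + 1 / 2) - t ^ 2) := by
      apply mul_nonneg (by linarith)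
      have : 2 * t / 3 * (3 * t - 16.09) * 1 ≤ 2 * t / 3 * (3 * t - 16.09) * (c + 1 / 2) := by
        apply mul_le_mul_of_nonneg_left (by linarith)
        apply mul_nonneg <;> linarith
      nlinarith
    nlinarith

/-- Chord bound for the convex function `s ↦ cosh √s` between `(r - a) ^ 2` and `(r + a) ^ 2`. -/
theorem cosh_le_chord {r a ρ w : ℝ} (hw0 : 0 ≤ w) (hw1 : w ≤ 1)
    (hρ : ρ ^ 2 = (1 - w) * (r - a) ^ 2 + w * (r + a) ^ 2) :
    Real.cosh ρ ≤ (1 - w) * Real.cosh (r - a) + w * Real.cosh (r + a) := by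
  refine hasSum_le (fun k => ?_) (Real.hasSum_cosh ρ)
    (((Real.hasSum_cosh (r - a)).mul_left (1 - w)).add ((Real.hasSum_cosh (r + a)).mul_left w))
  have h := (convexOn_pow (𝕜 := ℝ) k).2 (x := (r - a) ^ 2) (y := (r + a) ^ 2)
    (Set.mem_Ici.2 (sq_nonneg _)) (Set.mem_Ici.2 (sq_nonneg _)) (sub_nonneg.2 hw1) hw0 (by ring)
  simp only [smul_eq_mul] at h
  rw [← hρ] at h
  simp only [pow_mul, ← mul_div_assoc, ← add_div]
  gcongr

/-- The derivative of `r cosh r - sinh r` is `r sinh r ≥ 0`. -/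
theorem sinh_le_mul_cosh {r : ℝ} (hr : 0 ≤ r) : Real.sinh r ≤ r * Real.cosh r := by
  have hd : ∀ x : ℝ, HasDerivAt (fun x => x * Real.cosh x - Real.sinh x) (x * Real.sinh x) x := by
    intro x
    have := ((hasDerivAt_id x).mul (Real.hasDerivAt_cosh x)).sub (Real.hasDerivAt_sinh x)
    refine this.congr_deriv ?_
    simp
  have hm : MonotoneOn (fun x => x * Real.cosh x - Real.sinh x) (Set.Ici (0 : ℝ)) := by
    apply monotoneOn_of_deriv_nonneg (convex_Ici 0)
    · exact (Continuous.continuousOn (by fun_prop))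
    · exact fun x _ => (hd x).differentiableAt.differentiableWithinAt
    · intro x hx
      rw [interior_Ici] at hx
      rw [(hd x).deriv]
      exact mul_nonneg hx.le (Real.sinh_nonneg_iff.2 hx.le)
  have := hm (Set.mem_Ici.2 le_rfl) hr hr
  simp at this
  linarith

/-! ### Geometry of `(2, D)`-smooth spaces. -/

section Smooth

variable {E : Type*} [NormedAddCommGroup E] [NormedSpace ℝ E] {D : ℝ}

/-- A quadratic upper bound on the squared norm with the sharp constant `D ^ 2`. -/
theorem IsTwoSmooth.norm_add_sq_le (hD : IsTwoSmooth E D) {x : E} {f : StrongDual ℝ E}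
    (hf : ‖f‖ ≤ 1) (hfx : f x = ‖x‖) (y : E) :
    ‖x + y‖ ^ 2 ≤ ‖x‖ ^ 2 + 2 * ‖x‖ * f y + D ^ 2 * ‖y‖ ^ 2 := by
  -- Smoothness at the pair `x`, `y`, with `‖x - y‖ ≥ ‖x‖ - f y`, gives the constant `2D²`. Applied
  -- at `x + y/2` and `y/2`, it averages the current constant with `D²`, so each halving of `y`
  -- halves the excess.
  have key : ∀ n : ℕ, ∀ y : E,
      ‖x + y‖ ^ 2 ≤ ‖x‖ ^ 2 + 2 * ‖x‖ * f y + D ^ 2 * (1 + (1 / 2) ^ n) * ‖y‖ ^ 2 := by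
    intro n
    induction n with
    | zero =>
      intro y
      have h1 := hD.2 x y
      have h2 : ‖x‖ - f y ≤ ‖x - y‖ := by
        have := (le_abs_self _).trans ((f.le_opNorm (x - y)).trans
          (mul_le_of_le_one_left (norm_nonneg _) hf))
        simpa [hfx] using this
      have h3 : 2 * ‖x‖ * (‖x‖ - f y) - ‖x‖ ^ 2 ≤ ‖x - y‖ ^ 2 := by
        nlinarith [sq_nonneg (‖x - y‖ - ‖x‖), norm_nonneg x]
      norm_num
      nlinarith
    | succ n ih =>
      intro y
      have h1 := hD.2 (x + (1 / 2 : ℝ) • y) ((1 / 2 : ℝ) • y)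
      have h2 := ih ((1 / 2 : ℝ) • y)
      have e1 : x + (1 / 2 : ℝ) • y + (1 / 2 : ℝ) • y = x + y := by
        rw [add_assoc, ← add_smul]; norm_num
      rw [e1, add_sub_cancel_right] at h1
      have e2 : ‖(1 / 2 : ℝ) • y‖ = ‖y‖ / 2 := by
        rw [norm_smul]; norm_num; ring
      rw [e2] at h1 h2
      have e3 : f ((1 / 2 : ℝ) • y) = f y / 2 := by
        rw [map_smul, smul_eq_mul]; ring
      rw [e3] at h2
      rw [pow_succ (1 / 2 : ℝ) n]
      linarith
  have hlim : Filter.Tendsto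
      (fun n : ℕ => ‖x‖ ^ 2 + 2 * ‖x‖ * f y + D ^ 2 * (1 + (1 / 2 : ℝ) ^ n) * ‖y‖ ^ 2)
      Filter.atTop (nhds (‖x‖ ^ 2 + 2 * ‖x‖ * f y + D ^ 2 * (1 + 0) * ‖y‖ ^ 2)) :=
    (((((tendsto_pow_atTop_nhds_zero_of_lt_one (by norm_num) (by norm_num))).const_add
      _).const_mul _).mul_const _).const_add _
  rw [add_zero, mul_one] at hlim
  exact ge_of_tendsto' hlim fun n => key n y

/-- Take `x = 0` in the smoothness inequality. This makes the excess `D² - 1` over the Hilbert case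
nonnegative. -/
theorem IsTwoSmooth.one_le_sq {F : Type*} [NormedAddCommGroup F] (hD : IsTwoSmooth F D)
    {y : F} (hy : y ≠ 0) : 1 ≤ D ^ 2 := by
  have h := hD.2 0 y
  have hpos : 0 < ‖y‖ ^ 2 := by positivity
  simp at h
  by_contra hc
  nlinarith

/-- One step of Pinelis' exponential supermartingale in a `(2, D)`-smooth space. -/
theorem IsTwoSmooth.exists_cosh_norm_add_le (hD : IsTwoSmooth E D) (x : E) :
    ∃ l : StrongDual ℝ E, ∀ y : E, Real.cosh ‖x + y‖ ≤
      Real.cosh ‖x‖ * (1 + D ^ 2 * (Real.exp ‖y‖ - 1 - ‖y‖)) + l y := by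
  obtain ⟨f, hf, hfx⟩ := exists_dual_vector'' ℝ x
  replace hfx : f x = ‖x‖ := by simpa using hfx
  -- This is a subgradient of `cosh ‖·‖` at `x`, `f` being a supporting functional there.
  refine ⟨Real.sinh ‖x‖ • f, fun y => ?_⟩
  rcases eq_or_ne y 0 with rfl | hy
  · simp
  have hD1 := hD.one_le_sq hy
  have hq := hD.norm_add_sq_le hf hfx y
  have hup : ‖x + y‖ ≤ ‖x‖ + ‖y‖ := norm_add_le x y
  have hlow : |‖x‖ - ‖y‖| ≤ ‖x + y‖ := by
    simpa using abs_norm_sub_norm_le x (-y)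
  simp only [smul_apply, smul_eq_mul]
  have ha : 0 < ‖y‖ := norm_pos_iff.2 hy
  have hr : 0 ≤ ‖x‖ := norm_nonneg x
  have hρ : 0 ≤ ‖x + y‖ := norm_nonneg _
  have hfy : f y ≤ ‖y‖ := (le_abs_self _).trans ((f.le_opNorm y).trans
          (mul_le_of_le_one_left (norm_nonneg _) hf))
  generalize f y = φ at *
  generalize ‖x + y‖ = ρ at *
  generalize ‖x‖ = r at *
  generalize ‖y‖ = a at *
  have hsa : a ≤ Real.sinh a := Real.self_le_sinh_iff.2 ha.le
  have hsr : 0 ≤ Real.sinh r := Real.sinh_nonneg_iff.2 hr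
  have hsc : Real.sinh r ≤ Real.cosh r := (Real.sinh_lt_cosh r).le
  have hA := sq_div_two_le_exp_sub_one_sub_id ha.le
  have hexp : Real.exp a = Real.cosh a + Real.sinh a := (Real.cosh_add_sinh a).symm
  have hcr : 0 < Real.cosh r := Real.cosh_pos r
  obtain ⟨hw1, hw2⟩ : (r - a) ^ 2 ≤ ρ ^ 2 ∧ ρ ^ 2 ≤ (r + a) ^ 2 :=
    ⟨by rw [← sq_abs (r - a)]; gcongr, by gcongr⟩
  rcases hr.eq_or_lt with rfl | hr'
  · have : ρ = a := by
      have : ρ ^ 2 = a ^ 2 := by nlinarith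
      exact (pow_left_inj₀ hρ ha.le two_ne_zero).1 this
    subst this
    simp only [Real.cosh_zero, Real.sinh_zero, zero_mul, add_zero, one_mul]
    have : Real.exp ρ - 1 - ρ ≤ D ^ 2 * (Real.exp ρ - 1 - ρ) :=
      le_mul_of_one_le_left (exp_sub_one_sub_id_nonneg ρ) hD1
    linarith
  -- `ρ ^ 2 = r ^ 2 + a ^ 2 + 2 * r * g`
  obtain ⟨g, hg⟩ : ∃ g, ρ ^ 2 = r ^ 2 + a ^ 2 + 2 * r * g :=
    ⟨(ρ ^ 2 - r ^ 2 - a ^ 2) / (2 * r), by field_simp; ring⟩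
  have hga : g ≤ a := by nlinarith
  have hga' : -a ≤ g := by nlinarith
  have hgφ : 2 * r * (g - φ) ≤ (D ^ 2 - 1) * a ^ 2 := by nlinarith
  -- The number `g` plays the role of the inner product of `y` with `x/‖x‖`. The weight `w` is the
  -- one for which `ρ²` is the convex combination of `(r - a)²` and `(r + a)²`.
  have hchord := cosh_le_chord (r := r) (a := a) (ρ := ρ) (w := (1 + g / a) / 2)
    (by have : -1 ≤ g / a := by rw [le_div_iff₀ ha]; linarith
        linarith)
    (by have : g / a ≤ 1 := by rw [div_le_iff₀ ha]; linarith
        linarith)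
    (by rw [hg]; field_simp; ring)
  rw [Real.cosh_add, Real.cosh_sub] at hchord
  have h1 : Real.cosh ρ ≤ Real.cosh r * Real.cosh a + g / a * (Real.sinh r * Real.sinh a) := by
    linarith
  have h2 : g / a * (Real.sinh r * Real.sinh a) - g * Real.sinh r
      ≤ Real.cosh r * (Real.sinh a - a) := by
    have : g / a * (Real.sinh r * Real.sinh a) - g * Real.sinh r
        = g / a * (Real.sinh r * (Real.sinh a - a)) := by field_simp
    rw [this]
    have hb : 0 ≤ Real.sinh r * (Real.sinh a - a) := mul_nonneg hsr (by linarith)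
    calc g / a * (Real.sinh r * (Real.sinh a - a)) ≤ 1 * (Real.sinh r * (Real.sinh a - a)) := by
          apply mul_le_mul_of_nonneg_right _ hb
          rw [div_le_iff₀ ha]; linarith
      _ ≤ _ := by rw [one_mul]; apply mul_le_mul_of_nonneg_right hsc; linarith
  -- The price of not being in a Hilbert space: smoothness bounds `r (g - φ)` by `(D² - 1) a² / 2`,
  -- and `sinh r ≤ r cosh r` supplies the factor `r`.
  have h3 : (g - φ) * Real.sinh r ≤ Real.cosh r * ((D ^ 2 - 1) * (Real.exp a - 1 - a)) := by
    have hs := sinh_le_mul_cosh hr'.le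
    have hD0 : 0 ≤ D ^ 2 - 1 := by linarith
    have hE : 0 ≤ (D ^ 2 - 1) * (Real.exp a - 1 - a) :=
      mul_nonneg hD0 (exp_sub_one_sub_id_nonneg a)
    have hle : r * (g - φ) ≤ (D ^ 2 - 1) * (Real.exp a - 1 - a) := by
      have := mul_le_mul_of_nonneg_left hA hD0
      linarith
    rcases le_total (g - φ) 0 with hn | hp
    · exact (mul_nonpos_of_nonpos_of_nonneg hn hsr).trans (by positivity)
    · calc (g - φ) * Real.sinh r ≤ (g - φ) * (r * Real.cosh r) := by gcongr
        _ = Real.cosh r * (r * (g - φ)) := by ring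
        _ ≤ _ := by gcongr
  have h4 : Real.cosh r * (1 + D ^ 2 * (Real.exp a - 1 - a)) + Real.sinh r * φ
      = Real.cosh r * Real.cosh a + Real.cosh r * (Real.sinh a - a)
        + Real.cosh r * ((D ^ 2 - 1) * (Real.exp a - 1 - a)) + Real.sinh r * φ := by
    rw [hexp]; ring
  rw [h4]
  linarith

end Smooth

/-! ### Pinelis' supermartingale and the martingale tail bound. -/

/-- Any function of a strongly measurable map with finite range is strongly measurable. -/
theorem stronglyMeasurable_comp_of_finite_range {Ω E G : Type*} [NormedAddCommGroup E]
    [TopologicalSpace G] {m : MeasurableSpace Ω} {M : Ω → E} (hM : StronglyMeasurable[m] M)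
    (hfin : (Set.range M).Finite) (φ : E → G) : StronglyMeasurable[m] (fun ω => φ (M ω)) := by
  borelize E
  have hfin' : (Set.range fun ω => φ (M ω)).Finite :=
    (hfin.image φ).subset (by rintro _ ⟨ω, rfl⟩; exact ⟨M ω, ⟨ω, rfl⟩, rfl⟩)
  have hmeas : ∀ x, MeasurableSet[m] ((fun ω => φ (M ω)) ⁻¹' {x}) := by
    intro x
    have : (fun ω => φ (M ω)) ⁻¹' {x} = M ⁻¹' (Set.range M ∩ φ ⁻¹' {x}) := by
      ext ω; simp
    rw [this]
    exact hM.measurable (hfin.subset Set.inter_subset_left).measurableSet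
  exact (SimpleFunc.mk (fun ω => φ (M ω)) hmeas hfin').stronglyMeasurable

theorem exists_norm_le_of_finite_range {Ω E : Type*} [NormedAddCommGroup E] {M : Ω → E} (hfin : (Set.range M).Finite) :
    ∃ C, ∀ ω, ‖M ω‖ ≤ C := by
  obtain ⟨C, hC⟩ := hfin.isBounded.exists_norm_le
  exact ⟨C, fun ω => hC _ ⟨ω, rfl⟩⟩

theorem mul_le_of_nonneg_of_le_of_le_one {x y C : ℝ} (hx : 0 ≤ x) (hxC : x ≤ C) (hy : y ≤ 1) :
    x * y ≤ C :=
  (mul_le_of_le_one_right hx hy).trans hxC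

section Martingale

variable {E : Type*} [NormedAddCommGroup E] [NormedSpace ℝ E] [CompleteSpace E] {D : ℝ}
  {Ω : Type*} {mΩ : MeasurableSpace Ω} {μ : Measure Ω} [IsProbabilityMeasure μ]

theorem integral_mul_condExp_eq {m : MeasurableSpace Ω} (hm : m ≤ mΩ) {A g : Ω → ℝ}
    (hA : StronglyMeasurable[m] A) {C : ℝ} (hAb : ∀ᵐ ω ∂μ, ‖A ω‖ ≤ C) (hg : Integrable g μ) :
    ∫ ω, A ω * (μ[g | m]) ω ∂μ = ∫ ω, A ω * g ω ∂μ := by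
  have hint : Integrable (A * g) μ := hg.bdd_mul (hA.mono hm).aestronglyMeasurable hAb
  rw [← integral_condExp hm (f := fun ω => A ω * g ω)]
  exact integral_congr_ae (condExp_mul_of_stronglyMeasurable_left hA hint hg).symm

theorem integral_apply_eq_zero_of_condExp_eq_zero {m : MeasurableSpace Ω} (hm : m ≤ mΩ)
    {l : Ω → StrongDual ℝ E} {d : Ω → E} (hl : StronglyMeasurable[m] l) {C : ℝ}
    (hlb : ∀ᵐ ω ∂μ, ‖l ω‖ ≤ C) (hd : Integrable d μ) (h0 : μ[d | m] =ᵐ[μ] 0) :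
    ∫ ω, l ω (d ω) ∂μ = 0 := by
  have h := condExp_stronglyMeasurable_bilin_of_bound
    (ContinuousLinearMap.id ℝ (StrongDual ℝ E)) hm hl hd C hlb
  simp only [ContinuousLinearMap.id_apply] at h
  rw [← integral_condExp hm (f := fun ω => l ω (d ω)), integral_congr_ae h]
  rw [integral_eq_zero_of_ae]
  filter_upwards [h0] with ω hω
  simp [hω]

/-- One step of the exponential supermartingale. -/
theorem IsTwoSmooth.integral_cosh_step (hD : IsTwoSmooth E D) {m : MeasurableSpace Ω} (hm : m ≤ mΩ)
    {M d : Ω → E} (hM : StronglyMeasurable[m] M) (hMfin : (Set.range M).Finite)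
    (hd : StronglyMeasurable[mΩ] d) (hdfin : (Set.range d).Finite)
    (h0 : μ[d | m] =ᵐ[μ] 0) {a : ℝ} (ha : 0 < a) (hda : ∀ᵐ ω ∂μ, ‖d ω‖ ≤ a) {s : ℝ} (hs : 0 < s)
    {S : Ω → ℝ} (hS : StronglyMeasurable[m] S) (hS0 : ∀ᵐ ω ∂μ, 0 ≤ S ω) {c : ℝ}
    (hc : c = D ^ 2 * ((Real.exp (s * a) - 1 - s * a) / a ^ 2)) :
    ∫ ω, Real.cosh (s * ‖M ω + d ω‖) *
        Real.exp (-c * (S ω + (μ[fun ω => ‖d ω‖ ^ 2 | m]) ω)) ∂μ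
      ≤ ∫ ω, Real.cosh (s * ‖M ω‖) * Real.exp (-c * S ω) ∂μ := by
  have hc0 : 0 ≤ c := by
    rw [hc]
    have := exp_sub_one_sub_id_nonneg (s * a)
    positivity
  set W : Ω → ℝ := μ[fun ω => ‖d ω‖ ^ 2 | m] with hW
  have hWm : StronglyMeasurable[m] W := stronglyMeasurable_condExp
  have hW0 : ∀ᵐ ω ∂μ, 0 ≤ W ω := condExp_nonneg (ae_of_all _ fun ω => sq_nonneg _)
  -- The functionals are chosen with no regularity in `x`. The finite range of `M` is what makes `l
  -- (s • M ω)` measurable and bounded.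
  choose l hl using fun x : E => hD.exists_cosh_norm_add_le x
  obtain ⟨CM, hCM⟩ := exists_norm_le_of_finite_range hMfin
  obtain ⟨Cd, hCd⟩ := exists_norm_le_of_finite_range hdfin
  have hdint : Integrable d μ :=
    Integrable.of_bound hd.aestronglyMeasurable Cd (ae_of_all _ hCd)
  have hd2int : Integrable (fun ω => ‖d ω‖ ^ 2) μ := by
    refine Integrable.of_bound (hd.norm.pow 2).aestronglyMeasurable (Cd ^ 2) (ae_of_all _ ?_)
    intro ω
    rw [Real.norm_of_nonneg (sq_nonneg _)]
    exact pow_le_pow_left₀ (norm_nonneg _) (hCd ω) 2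
  -- the weights
  have hexpm : ∀ {T : Ω → ℝ}, StronglyMeasurable[m] T →
      StronglyMeasurable[m] fun ω => Real.exp (-c * T ω) := fun hT =>
    Real.continuous_exp.comp_stronglyMeasurable (hT.const_mul (-c))
  have hexp1 : ∀ t : ℝ, 0 ≤ t → Real.exp (-c * t) ≤ 1 := fun t ht =>
    Real.exp_le_one_iff.2 (by nlinarith [mul_nonneg hc0 ht])
  have hcoshM : StronglyMeasurable[m] fun ω => Real.cosh (s * ‖M ω‖) :=
    Real.continuous_cosh.comp_stronglyMeasurable (hM.norm.const_mul s)
  have hcosh_le : ∀ {x y : ℝ}, 0 ≤ x → x ≤ y → Real.cosh (s * x) ≤ Real.cosh (s * y) := by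
    intro x y hx hxy
    rw [Real.cosh_le_cosh, abs_of_nonneg (by positivity), abs_of_nonneg
      (mul_nonneg hs.le (hx.trans hxy))]
    gcongr
  set A : Ω → ℝ := fun ω => Real.cosh (s * ‖M ω‖) * Real.exp (-c * (S ω + W ω)) with hA
  have hAm : StronglyMeasurable[m] A := hcoshM.mul (hexpm (hS.add hWm))
  have hA0 : ∀ ω, 0 ≤ A ω := fun ω =>
    mul_nonneg (Real.cosh_pos _).le (Real.exp_pos _).le
  have hAb : ∀ᵐ ω ∂μ, ‖A ω‖ ≤ Real.cosh (s * CM) := by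
    filter_upwards [hS0, hW0] with ω h1 h2
    rw [Real.norm_of_nonneg (hA0 ω)]
    exact mul_le_of_nonneg_of_le_of_le_one (Real.cosh_pos _).le (hcosh_le (norm_nonneg _) (hCM ω)) (hexp1 _ (by linarith))
  set L : Ω → StrongDual ℝ E := fun ω =>
    (s * Real.exp (-c * (S ω + W ω))) • l (s • M ω) with hL
  have hLm : StronglyMeasurable[m] L :=
    ((hexpm (hS.add hWm)).const_mul s).smul
      (stronglyMeasurable_comp_of_finite_range hM hMfin fun x => l (s • x))
  obtain ⟨CL, hCL⟩ : ∃ C, ∀ ω, ‖l (s • M ω)‖ ≤ C := by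
    obtain ⟨C, hC⟩ := (hMfin.image fun x => l (s • x)).isBounded.exists_norm_le
    exact ⟨C, fun ω => hC _ ⟨M ω, ⟨ω, rfl⟩, rfl⟩⟩
  have hLb : ∀ᵐ ω ∂μ, ‖L ω‖ ≤ s * CL := by
    filter_upwards [hS0, hW0] with ω h1 h2
    rw [hL, norm_smul, norm_mul, Real.norm_of_nonneg hs.le, Real.norm_of_nonneg (Real.exp_pos _).le]
    gcongr
    · exact mul_le_of_le_one_right hs.le (hexp1 _ (by linarith))
    · exact hCL ω
  have hLint : Integrable (fun ω => L ω (d ω)) μ :=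
    (ContinuousLinearMap.id ℝ (StrongDual ℝ E)).integrable_of_bilin_of_bdd_left _
      (hLm.mono hm).aestronglyMeasurable hLb hdint
  have hAint : Integrable A μ :=
    Integrable.of_bound (hAm.mono hm).aestronglyMeasurable _ hAb
  have hAd : Integrable (fun ω => A ω * ‖d ω‖ ^ 2) μ :=
    hd2int.bdd_mul (hAm.mono hm).aestronglyMeasurable hAb
  have hAW : Integrable (fun ω => A ω * W ω) μ :=
    integrable_condExp.bdd_mul (hAm.mono hm).aestronglyMeasurable hAb
  have hpt : ∀ᵐ ω ∂μ, Real.cosh (s * ‖M ω + d ω‖) * Real.exp (-c * (S ω + W ω))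
      ≤ A ω + c * (A ω * ‖d ω‖ ^ 2) + L ω (d ω) := by
    filter_upwards [hda] with ω hω
    have h1 := hl (s • M ω) (s • d ω)
    rw [← smul_add, norm_smul, norm_smul, norm_smul, Real.norm_of_nonneg hs.le] at h1
    have h2 := exp_sub_one_sub_id_le_mul (u := s * ‖d ω‖) (a := s * a) (by positivity)
      (by gcongr) (by positivity)
    have h3 : D ^ 2 * (Real.exp (s * ‖d ω‖) - 1 - s * ‖d ω‖) ≤ c * ‖d ω‖ ^ 2 := by
      calc _ ≤ D ^ 2 * ((s * ‖d ω‖) ^ 2 * ((Real.exp (s * a) - 1 - s * a) / (s * a) ^ 2)) := by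
            gcongr
        _ = c * ‖d ω‖ ^ 2 := by rw [hc]; field_simp
    have h4 : Real.cosh (s * ‖M ω‖) * (1 + D ^ 2 * (Real.exp (s * ‖d ω‖) - 1 - s * ‖d ω‖))
        ≤ Real.cosh (s * ‖M ω‖) * (1 + c * ‖d ω‖ ^ 2) :=
      mul_le_mul_of_nonneg_left (by linarith) (Real.cosh_pos _).le
    calc _ ≤ (Real.cosh (s * ‖M ω‖) * (1 + c * ‖d ω‖ ^ 2) + l (s • M ω) (s • d ω))
          * Real.exp (-c * (S ω + W ω)) := by
          gcongr
          linarith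
      _ = _ := by
          simp only [hA, hL, smul_apply, map_smul, smul_eq_mul]
          ring
  have hLHS : Integrable (fun ω => Real.cosh (s * ‖M ω + d ω‖) *
      Real.exp (-c * (S ω + W ω))) μ := by
    refine Integrable.of_bound (C := Real.cosh (s * (CM + Cd))) ?_ ?_
    · exact ((Real.continuous_cosh.comp_stronglyMeasurable
        (((hM.mono hm).add hd).norm.const_mul s)).mul
          ((hexpm (hS.add hWm)).mono hm)).aestronglyMeasurable
    · filter_upwards [hS0, hW0] with ω h1 h2
      rw [Real.norm_of_nonneg (mul_nonneg (Real.cosh_pos _).le (Real.exp_pos _).le)]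
      exact mul_le_of_nonneg_of_le_of_le_one (Real.cosh_pos _).le (hcosh_le (norm_nonneg _)
        ((norm_add_le _ _).trans (add_le_add (hCM ω) (hCd ω)))) (hexp1 _ (by linarith))
  have hRHS : Integrable (fun ω => Real.cosh (s * ‖M ω‖) * Real.exp (-c * S ω)) μ := by
    refine Integrable.of_bound (C := Real.cosh (s * CM))
      ((hcoshM.mul (hexpm hS)).mono hm).aestronglyMeasurable ?_
    filter_upwards [hS0] with ω h1
    rw [Real.norm_of_nonneg (mul_nonneg (Real.cosh_pos _).le (Real.exp_pos _).le)]
    exact mul_le_of_nonneg_of_le_of_le_one (Real.cosh_pos _).le (hcosh_le (norm_nonneg _) (hCM ω)) (hexp1 _ h1)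
  calc _ ≤ ∫ ω, (A ω + c * (A ω * ‖d ω‖ ^ 2) + L ω (d ω)) ∂μ :=
        integral_mono_ae hLHS ((hAint.add (hAd.const_mul c)).add hLint) hpt
    _ = ∫ ω, (A ω + c * (A ω * W ω)) ∂μ := by
        have hsum : Integrable (fun ω => A ω + c * (A ω * ‖d ω‖ ^ 2)) μ :=
          hAint.add (hAd.const_mul c)
        rw [integral_add hsum hLint,
          integral_apply_eq_zero_of_condExp_eq_zero hm hLm hLb hdint h0, add_zero,
          integral_add hAint (hAd.const_mul c), integral_add hAint (hAW.const_mul c),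
          integral_const_mul, integral_const_mul, integral_mul_condExp_eq hm hAm hAb hd2int]
    _ ≤ _ := by
        refine integral_mono_ae (hAint.add (hAW.const_mul c)) hRHS (ae_of_all _ fun ω => ?_)
        -- It remains to absorb the factor `1 + c W` into the discount, by `1 + c W ≤ exp (c W)`.
        have h1 : Real.exp (-c * S ω) = Real.exp (-c * (S ω + W ω)) * Real.exp (c * W ω) := by
          rw [← Real.exp_add]; ring_nf
        simp only [hA, h1]
        have h2 := Real.add_one_le_exp (c * W ω)
        have h3 := mul_le_mul_of_nonneg_left h2 (hA0 ω)
        simp only [hA] at h3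
        linarith

/-- **Pinelis' exponential inequality** for martingales in a `(2, D)`-smooth Banach space. -/
theorem IsTwoSmooth.measure_norm_sum_ge_le (hD : IsTwoSmooth E D) (F : Filtration ℕ mΩ) (n : ℕ)
    (d : ℕ → Ω → E) (hd : ∀ k < n, StronglyMeasurable[F (k + 1)] (d k))
    (hfin : ∀ k < n, (Set.range (d k)).Finite) (h0 : ∀ k < n, μ[d k | F k] =ᵐ[μ] 0)
    {a : ℝ} (ha : 0 < a) (hda : ∀ k < n, ∀ᵐ ω ∂μ, ‖d k ω‖ ≤ a) {B : ℝ}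
    (hvar : ∀ᵐ ω ∂μ, ∑ k ∈ Finset.range n, (μ[fun ω => ‖d k ω‖ ^ 2 | F k]) ω ≤ B)
    {s r : ℝ} (hs : 0 < s) (hr : 0 < r) :
    μ.real {ω | r ≤ ‖∑ k ∈ Finset.range n, d k ω‖} ≤
      2 * Real.exp (-(s * r - D ^ 2 * B * ((Real.exp (s * a) - 1 - s * a) / a ^ 2))) := by
  obtain ⟨c, hc⟩ : ∃ c, c = D ^ 2 * ((Real.exp (s * a) - 1 - s * a) / a ^ 2) := ⟨_, rfl⟩
  have hc0 : 0 ≤ c := by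
    rw [hc]
    have := exp_sub_one_sub_id_nonneg (s * a)
    positivity
  have hMm : ∀ j ≤ n, StronglyMeasurable[F j] (fun ω => ∑ k ∈ Finset.range j, d k ω) := by
    intro j hj
    refine Finset.stronglyMeasurable_fun_sum _ fun k hk => ?_
    have hk := Finset.mem_range.1 hk
    exact (hd k (by omega)).mono (F.mono (by omega))
  have hMfin : ∀ j ≤ n, (Set.range fun ω => ∑ k ∈ Finset.range j, d k ω).Finite := by
    intro j
    induction j with
    | zero => intro _; simpa using Set.finite_range_const
    | succ j ih =>
      intro hj
      refine ((ih (by omega)).add (hfin j (by omega))).subset ?_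
      rintro _ ⟨ω, rfl⟩
      simp only [Finset.sum_range_succ]
      exact Set.add_mem_add ⟨ω, rfl⟩ ⟨ω, rfl⟩
  have hSm : ∀ j, StronglyMeasurable[F j]
      (fun ω => ∑ k ∈ Finset.range j, (μ[fun ω => ‖d k ω‖ ^ 2 | F k]) ω) := by
    intro j
    refine Finset.stronglyMeasurable_fun_sum _ fun k hk => ?_
    exact stronglyMeasurable_condExp.mono (F.mono (Finset.mem_range.1 hk).le)
  have hW0 : ∀ᵐ ω ∂μ, ∀ k, 0 ≤ (μ[fun ω => ‖d k ω‖ ^ 2 | F k]) ω :=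
    ae_all_iff.2 fun k => condExp_nonneg (ae_of_all _ fun ω => sq_nonneg _)
  have hS0 : ∀ j, ∀ᵐ ω ∂μ, 0 ≤ ∑ k ∈ Finset.range j, (μ[fun ω => ‖d k ω‖ ^ 2 | F k]) ω := by
    intro j
    filter_upwards [hW0] with ω hω using Finset.sum_nonneg fun k _ => hω k
  have hZ : ∀ j ≤ n, ∫ ω, Real.cosh (s * ‖∑ k ∈ Finset.range j, d k ω‖) *
      Real.exp (-c * ∑ k ∈ Finset.range j, (μ[fun ω => ‖d k ω‖ ^ 2 | F k]) ω) ∂μ ≤ 1 := by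
    intro j
    induction j with
    | zero => intro _; simp
    | succ j ih =>
      intro hj
      refine le_trans ?_ (ih (by omega))
      simp only [Finset.sum_range_succ]
      exact hD.integral_cosh_step (F.le j) (hMm j (by omega)) (hMfin j (by omega))
        ((hd j hj).mono (F.le _)) (hfin j hj) (h0 j hj) ha (hda j hj) hs (hSm j) (hS0 j) hc
  obtain ⟨CM, hCM⟩ := exists_norm_le_of_finite_range (hMfin n le_rfl)
  have hint : Integrable (fun ω => Real.cosh (s * ‖∑ k ∈ Finset.range n, d k ω‖) *
      Real.exp (-c * ∑ k ∈ Finset.range n, (μ[fun ω => ‖d k ω‖ ^ 2 | F k]) ω)) μ := by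
    refine Integrable.of_bound (C := Real.cosh (s * CM)) ?_ ?_
    · exact ((Real.continuous_cosh.comp_stronglyMeasurable
        ((hMm n le_rfl).norm.const_mul s)).mul (Real.continuous_exp.comp_stronglyMeasurable
          ((hSm n).const_mul (-c)))).mono (F.le n) |>.aestronglyMeasurable
    · filter_upwards [hS0 n] with ω h1
      rw [Real.norm_of_nonneg (mul_nonneg (Real.cosh_pos _).le (Real.exp_pos _).le)]
      refine mul_le_of_nonneg_of_le_of_le_one (Real.cosh_pos _).le ?_ (Real.exp_le_one_iff.2 (by nlinarith [mul_nonneg hc0 h1]))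
      rw [Real.cosh_le_cosh, abs_of_nonneg (by positivity), abs_of_nonneg
        (mul_nonneg hs.le ((norm_nonneg _).trans (hCM ω)))]
      exact mul_le_mul_of_nonneg_left (hCM ω) hs.le
  have hmarkov := mul_meas_ge_le_integral_of_nonneg (ae_of_all _ fun ω =>
    mul_nonneg (Real.cosh_pos _).le (Real.exp_pos _).le) hint
    (Real.cosh (s * r) * Real.exp (-c * B))
  -- Almost surely on the event, the discount is at least `exp (-c B)`, so the supermartingale
  -- exceeds the Markov threshold. The factor 2 of the conclusion comes from `cosh u ≥ exp u / 2`.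
  have hsub : μ.real {ω | r ≤ ‖∑ k ∈ Finset.range n, d k ω‖} ≤
      μ.real {ω | Real.cosh (s * r) * Real.exp (-c * B) ≤
        Real.cosh (s * ‖∑ k ∈ Finset.range n, d k ω‖) *
        Real.exp (-c * ∑ k ∈ Finset.range n, (μ[fun ω => ‖d k ω‖ ^ 2 | F k]) ω)} := by
    refine ENNReal.toReal_mono (measure_ne_top _ _) (measure_mono_ae ?_)
    filter_upwards [hvar] with ω hω hmem
    have hmem : r ≤ ‖∑ k ∈ Finset.range n, d k ω‖ := hmem
    refine mul_le_mul ?_ (Real.exp_le_exp.2 ?_) (Real.exp_pos _).le (Real.cosh_pos _).le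
    · rw [Real.cosh_le_cosh, abs_of_nonneg (by positivity), abs_of_nonneg (by positivity)]
      gcongr
    · nlinarith [mul_le_mul_of_nonneg_left hω hc0]
  have h1 := hmarkov.trans (hZ n le_rfl)
  have hcosh : Real.exp (s * r) / 2 ≤ Real.cosh (s * r) := by
    rw [Real.cosh_eq]
    have := Real.exp_pos (-(s * r))
    linarith
  have h2 : Real.exp (s * r - c * B) / 2 * μ.real {ω | r ≤ ‖∑ k ∈ Finset.range n, d k ω‖} ≤ 1 := by
    refine le_trans (mul_le_mul ?_ hsub measureReal_nonneg ?_) h1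
    · rw [sub_eq_add_neg, Real.exp_add, ← neg_mul, mul_div_right_comm]
      gcongr
    · exact mul_nonneg (Real.cosh_pos _).le (Real.exp_pos _).le
  have h3 : D ^ 2 * B * ((Real.exp (s * a) - 1 - s * a) / a ^ 2) = c * B := by rw [hc]; ring
  rw [h3, Real.exp_neg]
  have hpos := Real.exp_pos (s * r - c * B)
  rw [← div_eq_mul_inv, le_div_iff₀ hpos]
  linarith

end Martingale

/-! ### Combinatorics of injective tuples of labels. -/

section Tuples

variable {E : Type*} [NormedAddCommGroup E] {N m : ℕ}

/-- The sequence of sampled vectors of a tuple of labels, extended by zero. -/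
def tupleSeq (v : Fin N → E) (a : Fin m → Fin N) (i : ℕ) : E :=
  if h : i < m then v (a ⟨i, h⟩) else 0

theorem tupleSeq_coe (v : Fin N → E) (a : Fin m → Fin N) (k : Fin m) :
    tupleSeq v a k = v (a k) := by
  simp [tupleSeq]

theorem sum_range_tupleSeq (v : Fin N → E) (a : Fin m → Fin N) (k : Fin m) :
    ∑ i ∈ Finset.range k, tupleSeq v a i = ∑ i ∈ Finset.Iio k, v (a i) := by
  rw [← Nat.Iio_eq_range, ← Fin.map_valEmbedding_Iio, Finset.sum_map]
  simp [tupleSeq_coe]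

theorem sum_range_tupleSeq_self (v : Fin N → E) (a : Fin m → Fin N) :
    ∑ i ∈ Finset.range m, tupleSeq v a i = ∑ i, v (a i) := by
  rw [← Fin.sum_univ_eq_sum_range]
  simp [tupleSeq_coe]

/-- The labels that are not drawn before time `k`. -/
def remainingLabels (a : Fin m → Fin N) (k : Fin m) : Finset (Fin N) :=
  Finset.univ \ (Finset.Iio k).image a

theorem mem_remainingLabels {a : Fin m → Fin N} {k : Fin m} {j : Fin N} :
    j ∈ remainingLabels a k ↔ ∀ i < k, a i ≠ j := by
  simp [remainingLabels]

theorem sum_remainingLabels (v : Fin N → E) {a : Fin m → Fin N} (ha : Function.Injective a)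
    (k : Fin m) :
    ∑ j ∈ remainingLabels a k, v j = ∑ i, v i - ∑ i ∈ Finset.range k, tupleSeq v a i := by
  rw [sum_range_tupleSeq, remainingLabels, eq_sub_iff_add_eq,
    ← Finset.sum_image (s := Finset.Iio k) (g := a) (f := v) ha.injOn]
  exact Finset.sum_sdiff (Finset.subset_univ _)

theorem card_remainingLabels {a : Fin m → Fin N} (ha : Function.Injective a) (k : Fin m) :
    ((remainingLabels a k).card : ℝ) = (N : ℝ) - (k : ℕ) := by
  have h : (remainingLabels a k).card + ((Finset.Iio k).image a).card = N := by
    rw [remainingLabels, Finset.card_sdiff_add_card_eq_card (Finset.subset_univ _)]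
    simp
  rw [Finset.card_image_of_injective _ ha, Fin.card_Iio] at h
  rw [eq_sub_iff_add_eq]
  exact_mod_cast h

variable [NormedSpace ℝ E]

/-- The mean of the vectors that remain after the first `k` draws. -/
noncomputable def remainingMean (v : Fin N → E) (a : Fin m → Fin N) (k : ℕ) : E :=
  (1 / ((N : ℝ) - k)) • (∑ i, v i - ∑ i ∈ Finset.range k, tupleSeq v a i)

/-- The martingale differences of sampling without replacement. -/
noncomputable def drawIncrement (v : Fin N → E) (a : Fin m → Fin N) (k : ℕ) : E :=
  (1 / ((N : ℝ) - (k + 1))) • (tupleSeq v a k - remainingMean v a k)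

/-- The deviation of a draw from the mean of the remaining vectors. -/
theorem tupleSeq_sub_remainingMean (v : Fin N → E) {a : Fin m → Fin N}
    (ha : Function.Injective a) (k : Fin m) (hk : (k : ℕ) < N) :
    tupleSeq v a k - remainingMean v a k
      = (1 / ((N : ℝ) - (k : ℕ))) • ∑ j ∈ remainingLabels a k, (v (a k) - v j) := by
  have hpos : (N : ℝ) - (k : ℕ) ≠ 0 := sub_ne_zero.2 (by exact_mod_cast hk.ne')
  rw [Finset.sum_sub_distrib, Finset.sum_const, sum_remainingLabels v ha,
    ← Nat.cast_smul_eq_nsmul ℝ, card_remainingLabels ha, smul_sub, smul_smul,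
    one_div_mul_cancel hpos, one_smul, tupleSeq_coe]
  rfl

theorem norm_drawIncrement_le (v : Fin N → E) {R : ℝ} (hv : ∀ i, ‖v i‖ ≤ R)
    {a : Fin m → Fin N} (ha : Function.Injective a) (k : Fin m) (hk : (k : ℕ) + 1 < N) :
    ‖drawIncrement v a k‖ ≤ 2 * R / ((N : ℝ) - (k : ℕ)) := by
  have hk' : ((k : ℕ) : ℝ) + 1 < N := by exact_mod_cast hk
  have hsum : ‖∑ j ∈ remainingLabels a k, (v (a k) - v j)‖
      ≤ ((N : ℝ) - ((k : ℕ) + 1)) * (2 * R) := by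
    -- The current label is itself among the remaining ones and contributes zero. The other `N - k -
    -- 1` terms cancel the prefactor of the increment, leaving the denominator `N - k`.
    have hmem : a k ∈ remainingLabels a k :=
      mem_remainingLabels.2 fun i hi h => hi.ne (ha h)
    rw [← Finset.add_sum_erase _ _ hmem, sub_self, zero_add]
    refine (norm_sum_le_of_le (f := fun j => v (a k) - v j) _ (fun j _ =>
      (norm_sub_le _ _).trans (add_le_add (hv _) (hv _)))).trans ?_
    rw [Finset.sum_const, nsmul_eq_mul, Finset.card_erase_of_mem hmem, Nat.cast_sub
      (Finset.card_pos.2 ⟨_, hmem⟩), card_remainingLabels ha, Nat.cast_one]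
    apply le_of_eq
    ring
  rw [drawIncrement, tupleSeq_sub_remainingMean v ha k (by omega), norm_smul, norm_smul,
    Real.norm_of_nonneg (one_div_nonneg.2 (by linarith)),
    Real.norm_of_nonneg (one_div_nonneg.2 (by linarith))]
  have h1 : 0 < (N : ℝ) - ((k : ℕ) + 1) := by linarith
  have h2 : 0 < (N : ℝ) - (k : ℕ) := by linarith
  calc _ ≤ 1 / ((N : ℝ) - ((k : ℕ) + 1)) * (1 / ((N : ℝ) - (k : ℕ)) *
        (((N : ℝ) - ((k : ℕ) + 1)) * (2 * R))) := by gcongr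
    _ = _ := by field_simp

/-- The martingale differences add up to the normalised deviation of the partial sums. -/
theorem sum_drawIncrement (v : Fin N → E) (a : Fin m → Fin N) {n : ℕ} (hn : n < N) :
    ∑ k ∈ Finset.range n, drawIncrement v a k
      = (1 / ((N : ℝ) - n)) •
        (∑ i ∈ Finset.range n, tupleSeq v a i - ((n : ℝ) / N) • ∑ i, v i) := by
  induction n with
  | zero => simp
  | succ n ih =>
    rw [Finset.sum_range_succ, ih (by omega), drawIncrement, remainingMean,
      Finset.sum_range_succ]
    have h0 : (N : ℝ) ≠ 0 := Nat.cast_ne_zero.2 (by omega)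
    have h1 : ((n : ℕ) : ℝ) + 1 < N := by exact_mod_cast hn
    have h2 : (N : ℝ) - n ≠ 0 := by linarith
    have h3 : (N : ℝ) - (n + 1) ≠ 0 := by linarith
    push_cast
    match_scalars <;> field_simp <;> ring

/-- For a weight on tuples that is invariant under relabelling and supported on injective tuples,
and an event that depends on the first `k` draws only, the `k`-th deviation averages to zero. -/
theorem sum_deviation_eq_zero (v : Fin N → E) (k : Fin m) (hk : (k : ℕ) < N)
    (p : (Fin m → Fin N) → ℝ) (hp : ∀ (π : Equiv.Perm (Fin N)) a, p (π ∘ a) = p a)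
    (hp0 : ∀ a, ¬ Function.Injective a → p a = 0) (T : Set (Fin m → Fin N)) [DecidablePred (· ∈ T)]
    (hT : ∀ a b, (∀ i < k, a i = b i) → (a ∈ T ↔ b ∈ T)) :
    ∑ a, p a • (if a ∈ T then tupleSeq v a k - remainingMean v a k else 0) = 0 := by
  classical
  -- `G i j` collects the tuples in `T` whose `k`-th label is `i` while `j` is not drawn earlier.
  -- Exchanging `i` and `j` fixes all labels before `k`, hence membership in `T`, and turns `v i - v
  -- j` into its negative. So `G` is antisymmetric and its total vanishes.
  set G : Fin N → Fin N → E := fun i j =>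
    ∑ a, if a ∈ T ∧ j ∈ remainingLabels a k ∧ a k = i then p a • (v i - v j) else 0 with hG
  have hanti : ∀ i j, G i j = -G j i := by
    intro i j
    rw [hG]
    simp only
    rw [← Finset.sum_neg_distrib]
    refine Fintype.sum_equiv (Equiv.arrowCongr (Equiv.refl _) (Equiv.swap i j)) _ _ fun a => ?_
    have hcomp : Equiv.arrowCongr (Equiv.refl (Fin m)) (Equiv.swap i j) a = Equiv.swap i j ∘ a := by
      ext; simp
    rw [hcomp, hp]
    by_cases ha : Function.Injective a
    swap
    · simp [hp0 a ha]
    have hiff : (a ∈ T ∧ j ∈ remainingLabels a k ∧ a k = i) ↔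
        (Equiv.swap i j ∘ a ∈ T ∧ i ∈ remainingLabels (Equiv.swap i j ∘ a) k ∧
          (Equiv.swap i j ∘ a) k = j) := by
      simp only [mem_remainingLabels, Function.comp_apply]
      constructor
      · rintro ⟨h1, h2, h3⟩
        have h4 : ∀ l < k, Equiv.swap i j (a l) = a l := fun l hl =>
          Equiv.swap_apply_of_ne_of_ne (fun h => hl.ne (ha (h.trans h3.symm))) (h2 l hl)
        refine ⟨(hT a _ fun l hl => (h4 l hl).symm).1 h1, fun l hl => ?_, ?_⟩
        · rw [h4 l hl]
          exact fun h => hl.ne (ha (h.trans h3.symm))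
        · rw [h3, Equiv.swap_apply_left]
      · rintro ⟨h1, h2, h3⟩
        have h3' : a k = i := by
          have := congrArg (Equiv.swap i j) h3
          simpa using this
        have h2' : ∀ l < k, a l ≠ j := fun l hl h => h2 l hl (by rw [h, Equiv.swap_apply_right])
        have h4 : ∀ l < k, Equiv.swap i j (a l) = a l := fun l hl =>
          Equiv.swap_apply_of_ne_of_ne (fun h => hl.ne (ha (h.trans h3'.symm))) (h2' l hl)
        exact ⟨(hT a _ fun l hl => (h4 l hl).symm).2 h1, h2', h3'⟩
    simp only [hiff]
    split_ifs
    · rw [← smul_neg, neg_sub]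
    · simp
  have hzero : ∑ i, ∑ j, G i j = 0 := by
    have : ∑ i, ∑ j, G i j = -∑ i, ∑ j, G i j := by
      conv_lhs => rw [Finset.sum_comm]
      rw [← Finset.sum_neg_distrib]
      refine Finset.sum_congr rfl fun j _ => ?_
      rw [← Finset.sum_neg_distrib]
      exact Finset.sum_congr rfl fun i _ => hanti i j
    have h2 : (2 : ℝ) • ∑ i, ∑ j, G i j = 0 := by
      rw [two_smul]
      exact add_eq_zero_iff_eq_neg.2 this
    exact (smul_eq_zero.1 h2).resolve_left two_ne_zero
  have hmain : ∀ a, p a • (if a ∈ T then tupleSeq v a k - remainingMean v a k else 0)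
      = (1 / ((N : ℝ) - (k : ℕ))) • ∑ i, ∑ j,
        if a ∈ T ∧ j ∈ remainingLabels a k ∧ a k = i then p a • (v i - v j) else 0 := by
    intro a
    by_cases ha : Function.Injective a
    swap
    · simp [hp0 a ha]
    by_cases haT : a ∈ T
    swap
    · simp [haT]
    rw [if_pos haT, tupleSeq_sub_remainingMean v ha k hk, smul_comm]
    congr 1
    rw [Finset.sum_comm, Finset.smul_sum, ← Finset.sum_filter_add_sum_filter_not Finset.univ
      (fun j => j ∈ remainingLabels a k)]
    rw [Finset.sum_eq_zero (s := Finset.univ.filter fun j => ¬ j ∈ remainingLabels a k), add_zero]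
    · rw [Finset.filter_mem_eq_inter, Finset.univ_inter]
      refine Finset.sum_congr rfl fun j hj => ?_
      simp [haT, hj]
    · intro j hj
      simp [(Finset.mem_filter.1 hj).2]
  rw [Finset.sum_congr rfl fun a _ => hmain a, ← Finset.smul_sum, Finset.sum_comm]
  have : ∀ i, ∑ a, ∑ j, (if a ∈ T ∧ j ∈ remainingLabels a k ∧ a k = i
      then p a • (v i - v j) else 0) = ∑ j, G i j := fun i => Finset.sum_comm
  rw [Finset.sum_congr rfl fun i _ => this i, hzero, smul_zero]

end Tuples

/-! ### The law of the sample and its conditional moments. -/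

section Law

variable {Ω : Type*} {mΩ : MeasurableSpace Ω} {μ : Measure Ω} {N m : ℕ} {I : Fin m → Ω → Fin N}

theorem IsSamplingWithoutReplacement.measurable_tuple (hI : IsSamplingWithoutReplacement μ I) :
    Measurable fun ω k => I k ω :=
  measurable_pi_iff.2 hI.measurable

theorem IsSamplingWithoutReplacement.map_singleton (hI : IsSamplingWithoutReplacement μ I)
    {a : Fin m → Fin N} (ha : Function.Injective a) :
    μ.map (fun ω k => I k ω) {a} = ((N.descFactorial m : ℕ) : ℝ≥0∞)⁻¹ := by
  rw [Measure.map_apply hI.measurable_tuple (measurableSet_singleton _), ← hI.uniform a ha]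
  congr 1
  ext ω
  simp [funext_iff]

/-- The prescribed masses of the `N.descFactorial m` injective tuples already add up to one. -/
theorem IsSamplingWithoutReplacement.ae_injective [IsProbabilityMeasure μ]
    (hI : IsSamplingWithoutReplacement μ I) (hmN : m ≤ N) :
    ∀ᵐ ω ∂μ, Function.Injective fun k => I k ω := by
  classical
  have : IsProbabilityMeasure (μ.map fun ω k => I k ω) :=
    Measure.isProbabilityMeasure_map hI.measurable_tuple.aemeasurable
  suffices h : ∀ᵐ a ∂(μ.map fun ω k => I k ω), Function.Injective a from
    ae_of_ae_map hI.measurable_tuple.aemeasurable h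
  have hset : {a : Fin m → Fin N | Function.Injective a}
      = ↑(Finset.univ.filter fun a : Fin m → Fin N => Function.Injective a) := by
    ext; simp
  have hcard : (Finset.univ.filter fun a : Fin m → Fin N => Function.Injective a).card
      = N.descFactorial m := by
    rw [← Fintype.card_subtype, Fintype.card_congr
      (Equiv.subtypeInjectiveEquivEmbedding (Fin m) (Fin N)), Fintype.card_embedding_eq]
    simp
  have hone : (μ.map fun ω k => I k ω) {a | Function.Injective a} = 1 := by
    rw [hset, ← sum_measure_singleton, Finset.sum_congr rfl fun a ha =>
      hI.map_singleton (Finset.mem_filter.1 ha).2, Finset.sum_const, hcard, nsmul_eq_mul]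
    refine ENNReal.mul_inv_cancel ?_ (ENNReal.natCast_ne_top _)
    exact_mod_cast (Nat.descFactorial_pos.2 hmN).ne'
  rw [ae_iff]
  exact (prob_compl_eq_zero_iff (Set.toFinite _).measurableSet).2 hone

theorem IsSamplingWithoutReplacement.map_singleton_of_not_injective [IsProbabilityMeasure μ]
    (hI : IsSamplingWithoutReplacement μ I) (hmN : m ≤ N)
    {a : Fin m → Fin N} (ha : ¬ Function.Injective a) :
    μ.map (fun ω k => I k ω) {a} = 0 := by
  rw [Measure.map_apply hI.measurable_tuple (measurableSet_singleton _)]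
  refine measure_mono_null ?_ (ae_iff.1 (hI.ae_injective hmN))
  rintro ω rfl
  exact ha

/-- The information carried by the vectors drawn before time `j`. -/
def pastFiltration {E : Type*} [NormedAddCommGroup E] (v : Fin N → E)
    (hI : ∀ k, Measurable (I k)) : Filtration ℕ mΩ where
  seq j := ⨆ i : Fin m, ⨆ _ : (i : ℕ) < j, MeasurableSpace.comap (fun ω => v (I i ω)) (borel E)
  mono' _ _ h := iSup_mono fun _ => iSup_mono' fun hi => ⟨hi.trans_le h, le_rfl⟩
  le' j := by
    refine iSup₂_le fun i _ => ?_
    rintro _ ⟨t, -, rfl⟩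
    exact hI i (Set.toFinite (v ⁻¹' t)).measurableSet

variable {E : Type*} [NormedAddCommGroup E]

theorem stronglyMeasurable_pastFiltration (v : Fin N → E) (hI : ∀ k, Measurable (I k))
    {j : ℕ} (i : Fin m) (hij : (i : ℕ) < j) :
    StronglyMeasurable[pastFiltration v hI j] fun ω => v (I i ω) := by
  borelize E
  rw [stronglyMeasurable_iff_measurable_separable]
  constructor
  · intro t ht
    exact (le_iSup₂_of_le (f := fun (i : Fin m) (_ : (i : ℕ) < j) =>
      MeasurableSpace.comap (fun ω => v (I i ω)) (borel E)) i hij le_rfl) _ ⟨t, ht, rfl⟩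
  · exact ((Set.finite_range v).subset (by rintro _ ⟨ω, rfl⟩; exact ⟨_, rfl⟩)).isSeparable

/-- The vectors may repeat, so their past is in general coarser than that of the labels. This
passage to label events lets the exchange argument apply. -/
theorem exists_preimage_of_measurableSet_pastFiltration (v : Fin N → E)
    (hI : ∀ k, Measurable (I k)) (k : Fin m) {s : Set Ω}
    (hs : MeasurableSet[pastFiltration v hI k] s) :
    ∃ T : Set (Fin m → Fin N), s = (fun ω k => I k ω) ⁻¹' T ∧
      ∀ a b, (∀ i < k, a i = b i) → (a ∈ T ↔ b ∈ T) := by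
  have hle : (pastFiltration v hI k : MeasurableSpace Ω) ≤
      MeasurableSpace.comap (fun ω (i : Set.Iio k) => I i ω) ⊤ := by
    refine iSup₂_le fun i hi => ?_
    rintro _ ⟨t, -, rfl⟩
    exact ⟨{h | v (h ⟨i, hi⟩) ∈ t}, trivial, rfl⟩
  obtain ⟨S, -, rfl⟩ := hle s hs
  refine ⟨{a | (fun i : Set.Iio k => a i) ∈ S}, rfl, fun a b hab => ?_⟩
  have : (fun i : Set.Iio k => a i) = fun i : Set.Iio k => b i := funext fun i => hab i i.2
  simp [this]

theorem stronglyMeasurable_sum_tupleSeq (v : Fin N → E) (hI : ∀ k, Measurable (I k)) (j : ℕ) :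
    StronglyMeasurable[pastFiltration v hI j]
      fun ω => ∑ i ∈ Finset.range j, tupleSeq v (fun k => I k ω) i := by
  refine Finset.stronglyMeasurable_fun_sum _ fun i hi => ?_
  unfold tupleSeq
  split_ifs with h
  · exact stronglyMeasurable_pastFiltration v hI ⟨i, h⟩ (Finset.mem_range.1 hi)
  · exact stronglyMeasurable_const

theorem integrable_comp_tuple [IsProbabilityMeasure μ] (hI : ∀ k, Measurable (I k))
    (φ : (Fin m → Fin N) → E) : Integrable (fun ω => φ fun k => I k ω) μ := by
  have hJ : Measurable fun ω k => I k ω := measurable_pi_iff.2 hI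
  have : IsProbabilityMeasure (μ.map fun ω k => I k ω) :=
    Measure.isProbabilityMeasure_map hJ.aemeasurable
  exact (Integrable.of_finite (f := φ)).comp_measurable hJ

variable [NormedSpace ℝ E]

theorem stronglyMeasurable_remainingMean (v : Fin N → E) (hI : ∀ k, Measurable (I k)) (j : ℕ) :
    StronglyMeasurable[pastFiltration v hI j] fun ω => remainingMean v (fun k => I k ω) j :=
  (stronglyMeasurable_const.sub (stronglyMeasurable_sum_tupleSeq v hI j)).const_smul _

theorem stronglyMeasurable_drawIncrement (v : Fin N → E) (hI : ∀ k, Measurable (I k)) (k : Fin m) :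
    StronglyMeasurable[pastFiltration v hI (k + 1)]
      fun ω => drawIncrement v (fun k => I k ω) k := by
  refine StronglyMeasurable.const_smul (StronglyMeasurable.sub ?_
    ((stronglyMeasurable_remainingMean v hI k).mono
      ((pastFiltration v hI).mono (Nat.le_succ _)))) _
  simp only [tupleSeq_coe]
  exact stronglyMeasurable_pastFiltration v hI k (Nat.lt_succ_self _)

variable [CompleteSpace E] [IsProbabilityMeasure μ]

/-- The law of the tuple of labels is invariant under relabelling and vanishes off injective tuples,
so `sum_deviation_eq_zero` applies to its point masses. -/
theorem IsSamplingWithoutReplacement.setIntegral_deviation_eq_zero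
    (hI : IsSamplingWithoutReplacement μ I) (hmN : m ≤ N) (v : Fin N → E) (k : Fin m) {s : Set Ω}
    (hs : MeasurableSet[pastFiltration v hI.measurable k] s) :
    ∫ ω in s, (tupleSeq v (fun k => I k ω) k - remainingMean v (fun k => I k ω) k) ∂μ = 0 := by
  classical
  have hs' := (pastFiltration v hI.measurable).le k s hs
  obtain ⟨T, rfl, hT⟩ := exists_preimage_of_measurableSet_pastFiltration v hI.measurable k hs
  have : IsProbabilityMeasure (μ.map fun ω k => I k ω) :=
    Measure.isProbabilityMeasure_map hI.measurable_tuple.aemeasurable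
  rw [← integral_indicator hs']
  have h1 : ∀ ω, ((fun ω k => I k ω) ⁻¹' T).indicator (fun ω => tupleSeq v (fun k => I k ω) k
      - remainingMean v (fun k => I k ω) k) ω = (fun a : Fin m → Fin N =>
        if a ∈ T then tupleSeq v a k - remainingMean v a k else 0) (fun k => I k ω) := by
    intro ω
    simp [Set.indicator]
  rw [integral_congr_ae (ae_of_all _ h1), ← integral_map (μ := μ)
    (f := fun a : Fin m → Fin N => if a ∈ T then tupleSeq v a k - remainingMean v a k else 0)
    hI.measurable_tuple.aemeasurable (StronglyMeasurable.of_discrete).aestronglyMeasurable,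
    integral_fintype Integrable.of_finite]
  refine sum_deviation_eq_zero v k (k.2.trans_le hmN) _ (fun π a => ?_) (fun a ha => ?_) T hT
  · by_cases ha : Function.Injective a
    · rw [measureReal_def, measureReal_def, hI.map_singleton ha,
        hI.map_singleton (π.injective.comp ha)]
    · rw [measureReal_def, measureReal_def, hI.map_singleton_of_not_injective hmN ha,
        hI.map_singleton_of_not_injective hmN fun h => ha (Function.Injective.of_comp h)]
  · rw [measureReal_def, hI.map_singleton_of_not_injective hmN ha, ENNReal.toReal_zero]

/-- The conditional mean of a draw is the mean of the remaining vectors. -/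
theorem IsSamplingWithoutReplacement.condExp_eq (hI : IsSamplingWithoutReplacement μ I)
    (hmN : m ≤ N) (v : Fin N → E) (k : Fin m) :
    μ[fun ω => v (I k ω) | pastFiltration v hI.measurable k] =ᵐ[μ]
      fun ω => remainingMean v (fun k => I k ω) k := by
  symm
  refine ae_eq_condExp_of_forall_setIntegral_eq ((pastFiltration v hI.measurable).le k)
    (integrable_comp_tuple hI.measurable fun a => v (a k))
    (fun s _ _ => (integrable_comp_tuple hI.measurable fun a => remainingMean v a k).integrableOn)
    (fun s hs _ => ?_) (stronglyMeasurable_remainingMean v hI.measurable k).aestronglyMeasurable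
  have h := hI.setIntegral_deviation_eq_zero hmN v k hs
  rw [integral_sub (integrable_comp_tuple hI.measurable fun a => tupleSeq v a k).integrableOn
    (integrable_comp_tuple hI.measurable fun a => remainingMean v a k).integrableOn,
    sub_eq_zero] at h
  simp only [tupleSeq_coe] at h
  exact h.symm

theorem IsSamplingWithoutReplacement.condExp_drawIncrement
    (hI : IsSamplingWithoutReplacement μ I) (hmN : m ≤ N) (v : Fin N → E) (k : Fin m) :
    μ[fun ω => drawIncrement v (fun k => I k ω) k | pastFiltration v hI.measurable k]
      =ᵐ[μ] 0 := by
  have h1 := condExp_smul (μ := μ) (1 / ((N : ℝ) - ((k : ℕ) + 1)))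
    ((fun ω => v (I k ω)) - fun ω => remainingMean v (fun k => I k ω) k)
    (pastFiltration v hI.measurable k)
  have h2 := condExp_sub (integrable_comp_tuple (μ := μ) hI.measurable fun a => v (a k))
    (integrable_comp_tuple hI.measurable fun a => remainingMean v a k)
    (pastFiltration v hI.measurable k)
  have h3 := hI.condExp_eq hmN v k
  have h4 : μ[fun ω => remainingMean v (fun k => I k ω) k | pastFiltration v hI.measurable k]
      = fun ω => remainingMean v (fun k => I k ω) k :=
    condExp_of_stronglyMeasurable ((pastFiltration v hI.measurable).le k)
      (stronglyMeasurable_remainingMean v hI.measurable k)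
      (integrable_comp_tuple hI.measurable fun a => remainingMean v a k)
  have h5 : (fun ω => drawIncrement v (fun k => I k ω) k) = (1 / ((N : ℝ) - ((k : ℕ) + 1))) •
      ((fun ω => v (I k ω)) - fun ω => remainingMean v (fun k => I k ω) k) := by
    ext ω
    simp [drawIncrement, tupleSeq_coe]
  rw [h5]
  filter_upwards [h1, h2, h3] with ω e1 e2 e3
  rw [e1, Pi.smul_apply, e2, Pi.sub_apply, e3, h4]
  simp

theorem IsSamplingWithoutReplacement.condExp_norm_drawIncrement_sq
    (hI : IsSamplingWithoutReplacement μ I) (hmN : m ≤ N) (v : Fin N → E) (k : Fin m) :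
    μ[fun ω => ‖drawIncrement v (fun k => I k ω) k‖ ^ 2 | pastFiltration v hI.measurable k]
      =ᵐ[μ] fun ω => stepWeight N k * stepVariance μ (fun k ω => v (I k ω)) k ω := by
  have h1 : (fun ω => ‖drawIncrement v (fun k => I k ω) k‖ ^ 2) =ᵐ[μ]
      stepWeight N k • fun ω => ‖v (I k ω) -
        (μ[fun ω => v (I k ω) | pastSigma (fun k ω => v (I k ω)) k]) ω‖ ^ 2 := by
    filter_upwards [hI.condExp_eq hmN v k] with ω hω
    -- `pastSigma` at `k` and `pastFiltration` at `k` are the same σ-algebra by definition.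
    have hω' : (μ[fun ω => v (I k ω) | pastSigma (fun k ω => v (I k ω)) k]) ω
        = remainingMean v (fun k => I k ω) k := hω
    rw [Pi.smul_apply, hω', drawIncrement, norm_smul, mul_pow, Real.norm_eq_abs, sq_abs,
      one_div_pow, tupleSeq_coe]
    rfl
  refine (condExp_congr_ae h1).trans ?_
  exact condExp_smul _ _ _

end Law

/-! ### Weight sum, choice of the exponential parameter, and conclusion. -/

/-- With `n = N - m` fixed the sum is `∑ 1/l²` over `n ≤ l < n + m`. Raising `m` by one adds `1/(n +
m)²`, and the bound grows by at least that, with surplus `m / (n (n + m)² (n + m + 1))`. Equality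
holds at `m = 1`. -/
theorem sum_one_div_sq_le (N m : ℕ) (hmN : m < N) :
    ∑ k ∈ Finset.range m, 1 / ((N : ℝ) - (k + 1)) ^ 2
      ≤ m * ((N : ℝ) - m + 1) / (((N : ℝ) - m) ^ 2 * N) := by
  obtain ⟨n, rfl⟩ : ∃ n, N = n + m := ⟨N - m, by omega⟩
  have hn : 0 < n := by omega
  have hn' : (1 : ℝ) ≤ n := by exact_mod_cast hn
  clear hmN
  induction m with
  | zero => simp
  | succ m ih =>
    rw [Finset.sum_range_succ']
    push_cast at ih ⊢
    have e : ∀ k : ℕ, (n : ℝ) + (m + 1) - ((k : ℝ) + 1 + 1) = n + m - (k + 1) := fun k => by ring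
    simp only [e]
    have e1 : (n : ℝ) + m - m = n := by ring
    have e2 : (n : ℝ) + (m + 1) - (m + 1) = n := by ring
    have e3 : (n : ℝ) + (m + 1) - (0 + 1) = n + m := by ring
    rw [e1] at ih
    rw [e2, e3]
    have key : ((m : ℝ) + 1) * (n + 1) / ((n : ℝ) ^ 2 * (n + (m + 1)))
        - m * (n + 1) / ((n : ℝ) ^ 2 * (n + m)) - 1 / ((n : ℝ) + m) ^ 2
        = m / (n * (n + m) ^ 2 * (n + (m + 1))) := by
      field_simp
      ring
    have : (0 : ℝ) ≤ m / (n * (n + m) ^ 2 * (n + (m + 1))) := by positivity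
    linarith

/-- Optimisation of the exponential bound. -/
theorem le_of_forall_exponential_bound {P D q n m σ R ε : ℝ} (hn : 1 ≤ n) (hm : 0 < m)
    (hq : 0 < q) (hR : 0 < R) (hε : 0 < ε)
    (h : ∀ s : ℝ, 0 < s → P ≤ 2 * Real.exp (-(s * (m * ε / n) -
      D ^ 2 * (σ ^ 2 * (m * (n + 1) / (n ^ 2 * q))) *
        ((Real.exp (s * (2 * R / (n + 1))) - 1 - s * (2 * R / (n + 1))) /
          (2 * R / (n + 1)) ^ 2)))) :
    P ≤ 2 * Real.exp (-(m * ε ^ 2 /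
      (2 * (2 * D ^ 2 * (n / q) * σ ^ 2 + ε * R / 3)))) := by
  have hn0 : 0 < n := by linarith
  set a := 2 * R / (n + 1) with ha
  set b := D ^ 2 * (σ ^ 2 * (m * (n + 1) / (n ^ 2 * q))) with hb
  have ha0 : 0 < a := by positivity
  have hb0 : 0 ≤ b := by positivity
  suffices hs : ∃ s, 0 < s ∧ m * ε ^ 2 / (2 * (2 * D ^ 2 * (n / q) * σ ^ 2 + ε * R / 3)) ≤
      s * (m * ε / n) - b * ((Real.exp (s * a) - 1 - s * a) / a ^ 2) by
    obtain ⟨s, hs0, hs⟩ := hs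
    refine (h s hs0).trans ?_
    gcongr
  rcases hb0.eq_or_lt with hb0 | hb0
  · rw [← hb0]
    have hX : 0 < m * ε ^ 2 / (2 * (2 * D ^ 2 * (n / q) * σ ^ 2 + ε * R / 3)) := by positivity
    -- With zero variance the exponent is linear in `s`, and `s` is solved to hit the target
    -- exactly.
    refine ⟨m * ε ^ 2 / (2 * (2 * D ^ 2 * (n / q) * σ ^ 2 + ε * R / 3)) / (m * ε / n),
      by positivity, ?_⟩
    rw [div_mul_cancel₀ _ (by positivity)]
    simp
  -- With `θ = s a`, `r = m ε / n` and `t = r a / b`, the exponent is `(b / a²) (θ t - (exp θ - 1 -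
  -- θ))`. The target equals `c r² / (2b + 2c² r a / 3)` for `c = (n + 1)/(2n)`, and `n ≥ 1` puts
  -- `c` in `[1/2, 1]`.
  · obtain ⟨θ, hθ, hle⟩ := exists_rate_le (c := (n + 1) / (2 * n)) (t := m * ε / n * a / b)
      (by rw [div_le_div_iff₀ (by norm_num) (by positivity)]; linarith)
      (by rw [div_le_one (by positivity)]; linarith) (by positivity)
    refine ⟨θ / a, by positivity, ?_⟩
    rw [div_mul_cancel₀ _ ha0.ne']
    have h1 := mul_le_mul_of_nonneg_left hle (by positivity : 0 ≤ b / a ^ 2)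
    refine le_of_eq_of_le ?_ (h1.trans_eq ?_)
    · have e : b / a ^ 2 * ((n + 1) / (2 * n) * (m * ε / n * a / b) ^ 2 /
          (2 + 2 * ((n + 1) / (2 * n)) ^ 2 * (m * ε / n * a / b) / 3))
          = (n + 1) / (2 * n) * (m * ε / n) ^ 2 /
            (2 * b + 2 * ((n + 1) / (2 * n)) ^ 2 * (m * ε / n * a) / 3) := by
        field_simp
      rw [e, div_eq_div_iff (by positivity) (by positivity), ha, hb]
      field_simp
    · field_simp

theorem samplingSigma_sq_mul {Ω E : Type*} [MeasurableSpace Ω] [NormedAddCommGroup E]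
    [NormedSpace ℝ E] [CompleteSpace E] (μ : Measure Ω) (N : ℕ) {m : ℕ} (V : Fin m → Ω → E)
    (hW : 0 < ∑ k : Fin m, stepWeight N k) :
    samplingSigma μ N V ^ 2 * ∑ k : Fin m, stepWeight N k =
      (eLpNorm (fun ω => √(∑ k : Fin m, stepWeight N k * stepVariance μ V k ω)) ∞ μ).toReal
        ^ 2 := by
  rw [samplingSigma, mul_pow, one_div_pow, Real.sq_sqrt hW.le]
  field_simp

theorem mainTheorem8 {E : Type*} [NormedAddCommGroup E] [NormedSpace ℝ E] [CompleteSpace E]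
    (D : ℝ) (hD : IsTwoSmooth E D)
    {Ω : Type*} [MeasurableSpace Ω] (μ : Measure Ω) [IsProbabilityMeasure μ]
    (N m : ℕ) (hm : 1 ≤ m) (hmN : m < N)
    (v : Fin N → E) (I : Fin m → Ω → Fin N) (hI : IsSamplingWithoutReplacement μ I)
    (ε : ℝ) (hε : 0 < ε) :
    μ.real {ω | ε ≤ ‖(1 / (m : ℝ)) • ∑ k : Fin m, v (I k ω) - (1 / (N : ℝ)) • ∑ i : Fin N, v i‖}
      ≤ 2 * Real.exp (-(m * ε ^ 2 /
          (2 * (2 * D ^ 2 * (((N : ℝ) - m) / N) * samplingSigma μ N (fun k ω => v (I k ω)) ^ 2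
            + ε * (⨆ i : Fin N, ‖v i‖) / 3)))) := by
  have hm0 : (0 : ℝ) < m := by exact_mod_cast hm
  have hn : (1 : ℝ) ≤ (N : ℝ) - m := by
    have : (m : ℝ) + 1 ≤ N := by exact_mod_cast hmN
    linarith
  have hN0 : (0 : ℝ) < N := by linarith
  have hv : ∀ i, ‖v i‖ ≤ ⨆ i : Fin N, ‖v i‖ :=
    le_ciSup (f := fun i => ‖v i‖) (Set.finite_range _).bddAbove
  obtain ⟨R, hR⟩ : ∃ R, R = ⨆ i : Fin N, ‖v i‖ := ⟨_, rfl⟩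
  rw [← hR] at hv ⊢
  have hR0 : 0 ≤ R := (norm_nonneg _).trans (hv ⟨0, by omega⟩)
  -- If `R = 0` all vectors vanish and the event is empty; afterwards the bound `a` on the
  -- increments is positive.
  rcases hR0.eq_or_lt with hR0 | hR0
  · have hv0 : ∀ i, v i = 0 := fun i => norm_le_zero_iff.1 ((hv i).trans hR0.ge)
    have : {ω | ε ≤ ‖(1 / (m : ℝ)) • ∑ k : Fin m, v (I k ω) -
        (1 / (N : ℝ)) • ∑ i : Fin N, v i‖} = ∅ := by
      ext ω
      simp [hv0, hε]
    rw [this, measureReal_empty]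
    positivity
  set F := pastFiltration v hI.measurable with hF
  set d : ℕ → Ω → E := fun k ω => drawIncrement v (fun k => I k ω) k with hd
  set a : ℝ := 2 * R / ((N : ℝ) - m + 1) with ha
  have ha0 : 0 < a := by positivity
  have hda : ∀ k < m, ∀ᵐ ω ∂μ, ‖d k ω‖ ≤ a := by
    intro k hk
    filter_upwards [hI.ae_injective hmN.le] with ω hω
    refine (norm_drawIncrement_le v hv hω ⟨k, hk⟩ (by simp only; omega)).trans ?_
    have : (k : ℝ) + 1 ≤ m := by exact_mod_cast hk
    simp only [ha]
    gcongr
    linarith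
  have hdfin : ∀ k, (Set.range (d k)).Finite := fun k =>
    (Set.finite_range fun a : Fin m → Fin N => drawIncrement v a k).subset
      (by rintro _ ⟨ω, rfl⟩; exact ⟨_, rfl⟩)
  have hWpos : ∀ k : Fin m, 0 < stepWeight N k := by
    intro k
    have : ((k : ℕ) : ℝ) + 1 ≤ m := by exact_mod_cast k.2
    have : 0 < (N : ℝ) - (((k : ℕ) : ℝ) + 1) := by linarith
    rw [stepWeight]
    positivity
  have hW : 0 < ∑ k : Fin m, stepWeight N k :=
    Finset.sum_pos (fun k _ => hWpos k) ⟨⟨0, hm⟩, Finset.mem_univ _⟩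
  have hWle : ∑ k : Fin m, stepWeight N k
      ≤ m * ((N : ℝ) - m + 1) / (((N : ℝ) - m) ^ 2 * N) := by
    refine le_of_eq_of_le ?_ (sum_one_div_sq_le N m hmN)
    rw [← Fin.sum_univ_eq_sum_range]
    rfl
  have hcond : ∀ᵐ ω ∂μ, ∀ k : Fin m, (μ[fun ω => ‖d k ω‖ ^ 2 | F k]) ω =
      stepWeight N k * stepVariance μ (fun k ω => v (I k ω)) k ω :=
    ae_all_iff.2 fun k => hI.condExp_norm_drawIncrement_sq hmN.le v k
  have hcondle : ∀ᵐ ω ∂μ, ∀ k : Fin m, (μ[fun ω => ‖d k ω‖ ^ 2 | F k]) ω ≤ a ^ 2 := by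
    refine ae_all_iff.2 fun k => ?_
    have hint : Integrable (fun ω => ‖d k ω‖ ^ 2) μ :=
      integrable_comp_tuple hI.measurable fun a => ‖drawIncrement v a k‖ ^ 2
    have h := condExp_mono (m := F k) hint (integrable_const (a ^ 2))
      ((hda k k.2).mono fun ω hω => pow_le_pow_left₀ (norm_nonneg _) hω 2)
    rwa [condExp_const (F.le k)] at h
  set T := eLpNorm (fun ω => √(∑ k : Fin m, stepWeight N k *
    stepVariance μ (fun k ω => v (I k ω)) k ω)) ∞ μ with hT
  -- Finiteness is needed because `toReal` sends `∞` to 0, and `σ_m` would then bound nothing.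
  have hTfin : T ≠ ∞ := by
    rw [hT, eLpNorm_exponent_top]
    refine (eLpNormEssSup_lt_top_of_ae_bound (C := √(∑ _k : Fin m, a ^ 2)) ?_).ne
    filter_upwards [hcond, hcondle] with ω h1 h2
    rw [Real.norm_of_nonneg (Real.sqrt_nonneg _)]
    refine Real.sqrt_le_sqrt (Finset.sum_le_sum fun k _ => ?_)
    rw [← h1]
    exact h2 k
  have hvar : ∀ᵐ ω ∂μ, ∑ k ∈ Finset.range m, (μ[fun ω => ‖d k ω‖ ^ 2 | F k]) ω ≤
      samplingSigma μ N (fun k ω => v (I k ω)) ^ 2 *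
        (m * ((N : ℝ) - m + 1) / (((N : ℝ) - m) ^ 2 * N)) := by
    filter_upwards [hcond, ae_le_eLpNormEssSup (μ := μ) (f := fun ω => √(∑ k : Fin m,
      stepWeight N k * stepVariance μ (fun k ω => v (I k ω)) k ω))] with ω h1 h2
    rw [← eLpNorm_exponent_top, ← hT] at h2
    have h3 := (ENNReal.toReal_le_toReal enorm_ne_top hTfin).2 h2
    rw [toReal_enorm, Real.norm_of_nonneg (Real.sqrt_nonneg _), Real.sqrt_le_iff] at h3
    refine le_trans (le_of_eq ?_) (h3.2.trans ?_)
    · rw [← Fin.sum_univ_eq_sum_range fun k => (μ[fun ω => ‖d k ω‖ ^ 2 | F k]) ω]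
      exact Finset.sum_congr rfl fun k _ => h1 k
    · rw [hT, ← samplingSigma_sq_mul μ N _ hW]
      gcongr
  -- The final value of the martingale is the deviation of the sample mean scaled by `m/(N - m)`, so
  -- the threshold `ε` becomes `m ε / (N - m)`.
  have hset : {ω | ε ≤ ‖(1 / (m : ℝ)) • ∑ k : Fin m, v (I k ω) -
      (1 / (N : ℝ)) • ∑ i : Fin N, v i‖}
      = {ω | m * ε / ((N : ℝ) - m) ≤ ‖∑ k ∈ Finset.range m, d k ω‖} := by
    ext ω
    have e : ∑ k ∈ Finset.range m, d k ω = ((m : ℝ) / ((N : ℝ) - m)) •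
        ((1 / (m : ℝ)) • ∑ k : Fin m, v (I k ω) - (1 / (N : ℝ)) • ∑ i : Fin N, v i) := by
      rw [hd, sum_drawIncrement v _ hmN, sum_range_tupleSeq_self]
      have : (N : ℝ) - m ≠ 0 := by linarith
      match_scalars <;> field_simp
    have hpos : 0 < (m : ℝ) / ((N : ℝ) - m) := by positivity
    rw [Set.mem_ofPred_eq, Set.mem_ofPred_eq, e, norm_smul, Real.norm_of_nonneg hpos.le,
      mul_div_right_comm, mul_le_mul_iff_right₀ hpos]
  rw [hset]
  refine le_of_forall_exponential_bound hn hm0 hN0 hR0 hε fun s hs => ?_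
  exact hD.measure_norm_sum_ge_le F m d
    (fun k hk => stronglyMeasurable_drawIncrement v hI.measurable ⟨k, hk⟩) (fun k _ => hdfin k)
    (fun k hk => hI.condExp_drawIncrement hmN.le v ⟨k, hk⟩) ha0 hda hvar hs (by positivity)
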